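/- For a finite binary word $w=w_1\cdots w_n\in\{0,1\}^n$ and a nonempty binary word $\xi\in\{0,1\}^k$ ($k\ge 1$) let $$|w|_\xi=\#\{i : 0\le i\le n-k,\ w_{i+1}w_{i+2}\cdots w_{i+k}=\xi\}$$ be the number of (possibly overlapping) occurrences of $\xi$ in $w$, and let $$\Sigma(w)=\sum_{\xi\in\bigcup_{k\ge 1}\{0,1\}^k}|w|_\xi^2 .$$ Let $x_1x_2\cdots\in\{0,1\}^{\infty}$ be an infinite binary sequence. Then $x_1x_2\cdots$ is eventually periodic (that is, there are integers $h\ge 0$ and $k\ge 1$ with $x_{i+k}=x_i$ for all $i>h$) if and only if the limit $$\lim_{n\to\infty}\frac{\Sigma(x_1x_2\cdots x_n)}{n^3}$$ exists in $\mathbb{R}$ and is positive. -/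

import Mathlib

open Filter Topology

/-- A finite word over the alphabet `{0, 1}`. -/
abbrev BinWord : Type := List (Fin 2)

namespace BinWord

/-- `ξ` occurs in `w` with offset `i` (the offset of the first letter is `0`):
the whole of `ξ` fits into `w` from offset `i` on, and it agrees with `w` there. -/
def OccursAt (ξ w : BinWord) (i : ℕ) : Prop :=
  i + ξ.length ≤ w.length ∧ (w.drop i).take ξ.length = ξ

instance (ξ w : BinWord) : DecidablePred (OccursAt ξ w) := fun i =>
  inferInstanceAs (Decidable (i + ξ.length ≤ w.length ∧ (w.drop i).take ξ.length = ξ))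

/-- The number `|w|_ξ` of (possibly overlapping) occurrences of `ξ` in `w`. -/
def occ (w ξ : BinWord) : ℕ :=
  ((Finset.range (w.length + 1)).filter (OccursAt ξ w)).card

/-- The sum of `|w|_ξ ^ 2` over all nonempty binary words `ξ`. Only finitely many terms are nonzero,
see `finite_occ_ne_zero`. -/
noncomputable def sumSq (w : BinWord) : ℕ :=
  ∑ᶠ (ξ : BinWord) (_ : ξ ≠ []), occ w ξ ^ 2

theorem finite_occ_ne_zero (w : BinWord) : {ξ : BinWord | occ w ξ ≠ 0}.Finite := by
  refine (List.finite_length_le (Fin 2) w.length).subset ?_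
  intro ξ hξ
  obtain ⟨i, hi⟩ := Finset.card_pos.mp (Nat.pos_of_ne_zero hξ)
  have h := (Finset.mem_filter.mp hi).2.1
  simp only [Set.mem_ofPred_eq]
  omega

end BinWord

/-- The prefix of length `n` of an infinite binary sequence. The first letter is `x 0`. -/
def binPrefix (x : ℕ → Fin 2) (n : ℕ) : BinWord :=
  List.ofFn fun i : Fin n => x i

/-- From some index on, the sequence repeats with some positive period. -/
def EventuallyPeriodic (x : ℕ → Fin 2) : Prop :=
  ∃ h k : ℕ, 0 < k ∧ ∀ i, h ≤ i → x (i + k) = x i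

/-!
Write `S n` for `Σ` of the prefix of length `n`. It counts the pairs of equal nonempty factors of
the prefix; grouping them by their end positions gives `S n = ∑ a, ∑ b, lcs x a b`, where
`lcs x a b` is the length of the longest common suffix of the prefixes of lengths `a` and `b`
(`sumSq_binPrefix`). Hence `S (n + 1) = S n + (n + 1) + 2 * f (n + 1)`, where
`f n = ∑ a < n, lcs x a n` is `suffixOverlap x n`.

If `x` is eventually periodic with least period `p`, then `lcs x a b` for `a ≤ b` is
`a` when `p ∣ b - a` and `0` otherwise, up to a bounded error (`abs_lcs_sub_le`). So
`f n = n ^ 2 / (2 * p) + O(n)` and `S n = n ^ 3 / (3 * p) + O(n ^ 2)`.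

Conversely, let `S n / n ^ 3` converge to `L > 0`. Since `f (n + 1) ≤ f n + n`, a value of `f` that
is too small would keep `f` small on a whole interval `[n, (1 + ε) n]`, against the growth of `S`
there; so `f n ≥ (L / 2) * n ^ 2` for all large `n` (`le_suffixOverlap_of_tendsto`). This is where
the existence of the limit matters, and not only a positive upper limit. Because
`lcs x a n ≤ a`, a positive proportion of the `a < n` then have `lcs x a n` above any given bound,
and two of them are at distance `d < P` with `P` independent of `n`. So a suffix of the prefix of
length `n`, longer than `P!`, has period `d`, hence period `P!`, and `x (n - 1) = x (n - 1 - P!)`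
for all large `n` (`eventuallyPeriodic_of_le_suffixOverlap`).
-/

/-! ### Pairs of equal factors and longest common suffixes -/

/-- The length of the longest common suffix of the prefixes of `x` of lengths `a` and `b`. -/
def lcs (x : ℕ → Fin 2) : ℕ → ℕ → ℕ
  | 0, _ => 0
  | _ + 1, 0 => 0
  | a + 1, b + 1 => if x a = x b then lcs x a b + 1 else 0

theorem le_lcs_iff (x : ℕ → Fin 2) (a b k : ℕ) :
    k ≤ lcs x a b ↔ k ≤ a ∧ k ≤ b ∧ ∀ t < k, x (a - 1 - t) = x (b - 1 - t) := by
  induction a generalizing b k with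
  | zero =>
    simp only [lcs]
    refine ⟨fun h => ⟨h, by omega, fun t ht => by omega⟩, fun h => h.1⟩
  | succ a ih =>
    cases b with
    | zero =>
      simp only [lcs]
      refine ⟨fun h => ⟨by omega, h, fun t ht => by omega⟩, fun h => h.2.1⟩
    | succ b =>
      cases k with
      | zero => simp
      | succ k =>
        simp only [lcs]
        have key : (∀ t < k + 1, x (a + 1 - 1 - t) = x (b + 1 - 1 - t)) ↔
            x a = x b ∧ ∀ t < k, x (a - 1 - t) = x (b - 1 - t) := by
          rw [Nat.forall_lt_succ_left]
          simp [Nat.sub_sub, Nat.add_comm]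
        rw [key]
        by_cases h : x a = x b
        · simp [h, ih]
        · simp [h]

theorem lcs_comm (x : ℕ → Fin 2) (a b : ℕ) : lcs x a b = lcs x b a := by
  refine eq_of_forall_le_iff fun k => ?_
  rw [le_lcs_iff, le_lcs_iff]
  constructor <;> exact fun ⟨h₁, h₂, h⟩ => ⟨h₂, h₁, fun t ht => (h t ht).symm⟩

theorem lcs_le_left (x : ℕ → Fin 2) (a b : ℕ) : lcs x a b ≤ a :=
  ((le_lcs_iff x a b _).1 le_rfl).1

theorem lcs_self (x : ℕ → Fin 2) (a : ℕ) : lcs x a a = a :=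
  le_antisymm (lcs_le_left x a a) ((le_lcs_iff x a a a).2 ⟨le_rfl, le_rfl, fun _ _ => rfl⟩)

/-- The factor of `x` of length `k` that ends just before index `a`. The encoding is meaningful
for `k ≤ a`. -/
def factorEndingAt (x : ℕ → Fin 2) (a k : ℕ) : BinWord :=
  List.ofFn fun t : Fin k => x (a - k + t)

@[simp] theorem length_factorEndingAt (x : ℕ → Fin 2) (a k : ℕ) :
    (factorEndingAt x a k).length = k := by simp [factorEndingAt]

theorem factorEndingAt_eq_iff (x : ℕ → Fin 2) {a b k l : ℕ} (hk : k ≤ a) (hl : l ≤ b) :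
    factorEndingAt x a k = factorEndingAt x b l ↔ k = l ∧ k ≤ lcs x a b := by
  constructor
  · intro h
    have hkl : k = l := by simpa using congrArg List.length h
    subst hkl
    refine ⟨rfl, (le_lcs_iff x a b k).2 ⟨hk, hl, fun t ht => ?_⟩⟩
    have h' := congrFun (List.ofFn_injective h) ⟨k - 1 - t, by omega⟩
    simp only at h'
    rwa [show a - k + (k - 1 - t) = a - 1 - t by omega,
      show b - k + (k - 1 - t) = b - 1 - t by omega] at h'
  · rintro ⟨rfl, h⟩
    refine congrArg List.ofFn (funext fun t => ?_)
    have h' := ((le_lcs_iff x a b k).1 h).2.2 (k - 1 - t) (by omega)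
    rwa [show a - 1 - (k - 1 - t) = a - k + t by omega,
      show b - 1 - (k - 1 - t) = b - k + t by omega] at h'

theorem occursAt_binPrefix_iff (x : ℕ → Fin 2) (n : ℕ) (ξ : BinWord) (i : ℕ) :
    BinWord.OccursAt ξ (binPrefix x n) i ↔
      i + ξ.length ≤ n ∧ factorEndingAt x (i + ξ.length) ξ.length = ξ := by
  unfold BinWord.OccursAt
  have hlen : (binPrefix x n).length = n := by simp [binPrefix]
  rw [hlen]
  refine and_congr_right fun h => ?_
  have : ((binPrefix x n).drop i).take ξ.length =
      factorEndingAt x (i + ξ.length) ξ.length := by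
    apply List.ext_getElem
    · simp [hlen]; omega
    · intro t h₁ h₂
      simp [binPrefix, factorEndingAt]
  rw [this]

/-- End positions and lengths `⟨a, k⟩` of the nonempty factors of the prefix of length `n`. -/
def factorIndex (n : ℕ) : Finset (Σ _ : ℕ, ℕ) :=
  (Finset.range (n + 1)).sigma fun a => Finset.Icc 1 a

theorem occ_binPrefix (x : ℕ → Fin 2) (n : ℕ) {ξ : BinWord} (hξ : ξ ≠ []) :
    BinWord.occ (binPrefix x n) ξ =
      ((factorIndex n).filter fun p => factorEndingAt x p.1 p.2 = ξ).card := by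
  have hpos : 1 ≤ ξ.length := List.length_pos_iff.2 hξ
  unfold BinWord.occ
  refine Finset.card_bij' (fun i _ => ⟨i + ξ.length, ξ.length⟩) (fun p _ => p.1 - p.2) ?_ ?_ ?_ ?_
  · intro i hi
    have h := (occursAt_binPrefix_iff x n ξ i).1 (Finset.mem_filter.1 hi).2
    simp only [factorIndex, Finset.mem_filter, Finset.mem_sigma, Finset.mem_range, Finset.mem_Icc]
    exact ⟨⟨by omega, hpos, by omega⟩, h.2⟩
  · rintro ⟨a, k⟩ hp
    simp only [factorIndex, Finset.mem_filter, Finset.mem_sigma, Finset.mem_range,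
      Finset.mem_Icc] at hp
    obtain ⟨⟨ha, hk, hka⟩, h⟩ := hp
    have hlen : ξ.length = k := by rw [← h, length_factorEndingAt]
    have hn : (binPrefix x n).length = n := by simp [binPrefix]
    rw [Finset.mem_filter, Finset.mem_range, hn, occursAt_binPrefix_iff, hlen,
      Nat.sub_add_cancel hka]
    exact ⟨by simp only; omega, by omega, h⟩
  · intro i _
    simp
  · rintro ⟨a, k⟩ hp
    simp only [factorIndex, Finset.mem_filter, Finset.mem_sigma, Finset.mem_range,
      Finset.mem_Icc] at hp
    obtain ⟨⟨ha, hk, hka⟩, h⟩ := hp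
    have hlen : ξ.length = k := by rw [← h, length_factorEndingAt]
    simp [hlen, Nat.sub_add_cancel hka]

/-- The fibres of a map, counted with squares, count the pairs of points with equal image. -/
theorem Finset.sum_card_fiber_sq {ι κ : Type*} [DecidableEq κ] (s : Finset ι) (g : ι → κ)
    (t : Finset κ) (hg : ∀ i ∈ s, g i ∈ t) :
    ∑ y ∈ t, (s.filter fun i => g i = y).card ^ 2 =
      ∑ i ∈ s, (s.filter fun j => g i = g j).card := by
  rw [← Finset.sum_fiberwise_of_maps_to hg]
  refine Finset.sum_congr rfl fun y _ => ?_
  rw [Finset.sum_congr rfl (g := fun _ => (s.filter fun i => g i = y).card), Finset.sum_const,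
    smul_eq_mul, sq]
  intro i hi
  simp only [(Finset.mem_filter.1 hi).2, eq_comm]

/-- `Σ(w)` counts pairs of equal nonempty factors; sorting these by their end positions turns it
into a sum of longest common suffixes. -/
theorem sumSq_binPrefix (x : ℕ → Fin 2) (n : ℕ) :
    BinWord.sumSq (binPrefix x n) =
      ∑ a ∈ Finset.range (n + 1), ∑ b ∈ Finset.range (n + 1), lcs x a b := by
  classical
  set g : (Σ _ : ℕ, ℕ) → BinWord := fun p => factorEndingAt x p.1 p.2 with hg
  have h₁ : BinWord.sumSq (binPrefix x n) =
      ∑ ξ ∈ (factorIndex n).image g, ((factorIndex n).filter fun p => g p = ξ).card ^ 2 := by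
    have h₀ : ∀ ξ : BinWord, (∑ᶠ _ : ξ ≠ [], BinWord.occ (binPrefix x n) ξ ^ 2) =
        ((factorIndex n).filter fun p => g p = ξ).card ^ 2 := by
      intro ξ
      by_cases hξ : ξ = []
      · have h_empty : ((factorIndex n).filter fun p => g p = ξ) = ∅ := by
          refine Finset.filter_eq_empty_iff.2 ?_
          rintro ⟨a, k⟩ hp h
          simp only [factorIndex, Finset.mem_sigma, Finset.mem_range, Finset.mem_Icc] at hp
          have := congrArg List.length h
          simp [hg, hξ] at this
          omega
        rw [h_empty]
        simp [hξ]
      · simp only [ne_eq, hξ, not_false_eq_true, finsum_true, hg]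
        rw [occ_binPrefix x n hξ]
    unfold BinWord.sumSq
    rw [finsum_congr h₀]
    refine finsum_eq_sum_of_support_subset _ fun ξ hξ => ?_
    have hne : ((factorIndex n).filter fun p => g p = ξ).card ≠ 0 := by
      intro h; simp [h] at hξ
    obtain ⟨p, hp⟩ := Finset.card_pos.1 (Nat.pos_of_ne_zero hne)
    rw [Finset.mem_filter] at hp
    exact Finset.mem_coe.2 (Finset.mem_image.2 ⟨p, hp⟩)
  rw [h₁, Finset.sum_card_fiber_sq _ _ _ fun i hi => Finset.mem_image_of_mem _ hi]
  simp only [Finset.card_filter]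
  unfold factorIndex
  rw [Finset.sum_sigma]
  refine Finset.sum_congr rfl fun a _ => ?_
  simp only [Finset.sum_sigma]
  rw [Finset.sum_comm]
  refine Finset.sum_congr rfl fun b _ => ?_
  have h₂ : ∀ k ∈ Finset.Icc 1 a, (∑ l ∈ Finset.Icc 1 b, if g ⟨a, k⟩ = g ⟨b, l⟩ then 1 else 0) =
      if k ≤ lcs x a b then 1 else 0 := by
    intro k hk
    rw [Finset.mem_Icc] at hk
    have hb : lcs x a b ≤ b := lcs_comm x a b ▸ lcs_le_left x b a
    have h₃ : ∀ l ∈ Finset.Icc 1 b, (if g ⟨a, k⟩ = g ⟨b, l⟩ then 1 else 0) =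
        if k = l then (if k ≤ lcs x a b then 1 else 0) else 0 := by
      intro l hl
      simp only [hg, factorEndingAt_eq_iff x hk.2 (Finset.mem_Icc.1 hl).2]
      by_cases hkl : k = l
      · simp only [hkl, true_and, if_true]
      · simp only [hkl, false_and, if_false]
    rw [Finset.sum_congr rfl h₃, Finset.sum_ite_eq]
    by_cases h : k ≤ lcs x a b
    · simp [h, hk.1, h.trans hb]
    · simp [h]
  rw [Finset.sum_congr rfl h₂, ← Finset.card_filter]
  have h₄ : (Finset.Icc 1 a).filter (fun k => k ≤ lcs x a b) = Finset.Icc 1 (lcs x a b) := by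
    have := lcs_le_left x a b
    ext k
    simp only [Finset.mem_filter, Finset.mem_Icc]
    omega
  rw [h₄]
  simp

/-- The total length of the longest common suffixes of the prefix of length `n` with the shorter
prefixes. -/
def suffixOverlap (x : ℕ → Fin 2) (n : ℕ) : ℕ := ∑ a ∈ Finset.range n, lcs x a n

theorem sumSq_binPrefix_succ (x : ℕ → Fin 2) (n : ℕ) :
    BinWord.sumSq (binPrefix x (n + 1)) =
      BinWord.sumSq (binPrefix x n) + (n + 1) + 2 * suffixOverlap x (n + 1) := by
  simp only [sumSq_binPrefix]
  rw [Finset.sum_range_succ _ (n + 1), Finset.sum_range_succ _ (n + 1), lcs_self]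
  simp only [Finset.sum_range_succ _ (n + 1), Finset.sum_add_distrib]
  have : ∑ b ∈ Finset.range (n + 1), lcs x (n + 1) b = suffixOverlap x (n + 1) :=
    Finset.sum_congr rfl fun b _ => lcs_comm _ _ _
  rw [this]
  unfold suffixOverlap
  ring

/-- One more letter raises each of the longest common suffixes by at most `1`. -/
theorem suffixOverlap_succ_le (x : ℕ → Fin 2) (n : ℕ) :
    suffixOverlap x (n + 1) ≤ suffixOverlap x n + n := by
  unfold suffixOverlap
  rw [Finset.sum_range_succ']
  simp only [lcs, add_zero]
  calc ∑ a ∈ Finset.range n, (if x a = x n then lcs x a n + 1 else 0)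
      ≤ ∑ a ∈ Finset.range n, (lcs x a n + 1) :=
        Finset.sum_le_sum fun a _ => by split_ifs <;> omega
    _ = _ := by simp [Finset.sum_add_distrib]

/-! ### From cubic growth to periodicity -/

/-- If the word of length `K` ending at `n` also ends at `a` and at `a + d`, then it has
period `d`. -/
theorem apply_sub_mul_eq_of_le_lcs {x : ℕ → Fin 2} {K a d n : ℕ} (h₁ : K ≤ lcs x a n)
    (h₂ : K ≤ lcs x (a + d) n) (j : ℕ) (hj : j * d < K) : x (n - 1 - j * d) = x (n - 1) := by
  induction j with
  | zero => simp
  | succ j ih =>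
    rw [Nat.succ_mul] at hj ⊢
    rw [← ih (by omega), ← ((le_lcs_iff x _ _ _).1 h₁).2.2 (j * d) (by omega),
      ← ((le_lcs_iff x _ _ _).1 h₂).2.2 (j * d + d) hj]
    congr 1
    omega

/-- Among more than `n / P + 1` numbers below `n`, two are at distance less than `P`. -/
theorem exists_add_mem_of_lt_card {A : Finset ℕ} {n P : ℕ} (hP : 0 < P)
    (hA : ∀ a ∈ A, a < n) (hcard : n / P + 1 < A.card) :
    ∃ a d, a ∈ A ∧ a + d ∈ A ∧ 0 < d ∧ d < P := by
  have hmaps : ∀ a ∈ A, a / P ∈ Finset.range (n / P + 1) := fun a ha =>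
    Finset.mem_range.2 (Nat.lt_succ_of_le (Nat.div_le_div_right (hA a ha).le))
  obtain ⟨a, ha, b, hb, hab, hdiv⟩ :=
    Finset.exists_ne_map_eq_of_card_lt_of_maps_to (by simpa using hcard) hmaps
  wlog hlt : a < b generalizing a b
  · exact this b hb a ha hab.symm hdiv.symm (by omega)
  refine ⟨a, b - a, ha, by rwa [Nat.add_sub_cancel' hlt.le], by omega, ?_⟩
  have h₁ := Nat.div_add_mod a P
  have h₂ := Nat.div_add_mod b P
  have h₃ := Nat.mod_lt b hP
  rw [hdiv] at h₁
  omega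

theorem suffixOverlap_le (x : ℕ → Fin 2) (n K : ℕ) :
    suffixOverlap x n ≤ n * ((Finset.range n).filter fun a => K ≤ lcs x a n).card + K * n := by
  unfold suffixOverlap
  calc ∑ a ∈ Finset.range n, lcs x a n
      ≤ ∑ a ∈ Finset.range n, ((if K ≤ lcs x a n then n else 0) + K) := by
        refine Finset.sum_le_sum fun a ha => ?_
        have h₁ := lcs_le_left x a n
        have h₂ := Finset.mem_range.1 ha
        split_ifs <;> omega
    _ = _ := by
        rw [Finset.sum_add_distrib, ← Finset.sum_filter]
        simp [mul_comm]

/-- A quadratic lower bound for the overlaps makes a fixed long suffix of every prefix recur at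
bounded gaps, so that suffix has a bounded period. A common multiple of these periods is a period
of the tail. -/
theorem eventuallyPeriodic_of_le_suffixOverlap {x : ℕ → Fin 2} {c : ℝ} (hc : 0 < c)
    (h : ∀ᶠ n : ℕ in atTop, c * (n : ℝ) ^ 2 ≤ suffixOverlap x n) : EventuallyPeriodic x := by
  obtain ⟨P, hP⟩ := exists_nat_gt (2 / c)
  have hP0 : (0 : ℝ) < P := lt_trans (by positivity) hP
  have hPpos : 0 < P := by exact_mod_cast hP0
  set Q := P.factorial with hQ
  obtain ⟨N, hN⟩ := eventually_atTop.1 h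
  obtain ⟨M, hM⟩ := exists_nat_gt (2 * (Q + 2) / c)
  have key : ∀ n, N ≤ n → M ≤ n → 0 < n → x (n - 1 - Q) = x (n - 1) := by
    intro n hn hMn hn0
    have hn0' : (0 : ℝ) < n := by exact_mod_cast hn0
    set A := (Finset.range n).filter fun a => Q + 1 ≤ lcs x a n with hA
    have h₁ : (suffixOverlap x n : ℝ) ≤ n * A.card + (Q + 1) * n := by
      exact_mod_cast suffixOverlap_le x n (Q + 1)
    have h₂ := hN n hn
    have h₃ : c * n ≤ A.card + (Q + 1) := by
      refine le_of_mul_le_mul_left ?_ hn0'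
      nlinarith
    have h₄ : 2 * (Q + 2) < c * n := by
      have : (2 * (Q + 2) / c : ℝ) < n := hM.trans_le (by exact_mod_cast hMn)
      rw [div_lt_iff₀ hc] at this
      linarith
    have h₅ : (n : ℝ) / P ≤ c * n / 2 := by
      rw [div_lt_iff₀ hc] at hP
      rw [div_le_div_iff₀ hP0 two_pos]
      nlinarith
    have h₆ : ((n / P : ℕ) : ℝ) ≤ n / P := Nat.cast_div_le
    have hcard : n / P + 1 < A.card := by
      have : ((n / P : ℕ) : ℝ) + 1 < A.card := by linarith
      exact_mod_cast this
    obtain ⟨a, d, ha, had, hd0, hdP⟩ := exists_add_mem_of_lt_card hPpos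
      (fun a ha => Finset.mem_range.1 (Finset.mem_filter.1 ha).1) hcard
    obtain ⟨j, hj⟩ : d ∣ Q := Nat.dvd_factorial hd0 hdP.le
    have := apply_sub_mul_eq_of_le_lcs (Finset.mem_filter.1 ha).2 (Finset.mem_filter.1 had).2 j
      (by rw [mul_comm, ← hj]; omega)
    rwa [mul_comm j d, ← hj] at this
  refine ⟨N + M, Q, Nat.factorial_pos P, fun i hi => ?_⟩
  have := key (i + Q + 1) (by omega) (by omega) (by omega)
  simpa using this.symm

theorem suffixOverlap_add_le (x : ℕ → Fin 2) (n k : ℕ) :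
    suffixOverlap x (n + k) ≤ suffixOverlap x n + k * (n + k) := by
  induction k with
  | zero => simp
  | succ k ih =>
    have := suffixOverlap_succ_le x (n + k)
    rw [← add_assoc]
    nlinarith

theorem sumSq_binPrefix_add_le (x : ℕ → Fin 2) (n k : ℕ) :
    BinWord.sumSq (binPrefix x (n + k)) ≤ BinWord.sumSq (binPrefix x n) +
      k * (n + k + 2 * (suffixOverlap x n + k * (n + k))) := by
  induction k with
  | zero => simp
  | succ k ih =>
    have h₁ := suffixOverlap_add_le x n (k + 1)
    rw [← add_assoc, sumSq_binPrefix_succ]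
    rw [← add_assoc] at h₁
    nlinarith

/-- If `Σ` grows like `L * n ^ 3`, its increments over `[n, (1 + ε) * n]` are cubic; since the
overlap increases slowly, it must be at least quadratic already at `n`. -/
theorem le_suffixOverlap_of_tendsto {x : ℕ → Fin 2} {L : ℝ} (hL : 0 < L)
    (h : Tendsto (fun n : ℕ => (BinWord.sumSq (binPrefix x n) : ℝ) / (n : ℝ) ^ 3) atTop (𝓝 L)) :
    ∀ᶠ n : ℕ in atTop, L / 2 * (n : ℝ) ^ 2 ≤ suffixOverlap x n := by
  -- the relative step `ε` is cut off at `1`, so that `(n + k) ^ 3 ≤ 8 * n ^ 3`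
  set ε := min (L / 4) 1 with hε
  have hε0 : 0 < ε := lt_min (by positivity) one_pos
  have hεL : ε ≤ L / 4 := min_le_left _ _
  have hε1 : ε ≤ 1 := min_le_right _ _
  set δ := L * ε / 40 with hδ
  have hδ0 : 0 < δ := by positivity
  obtain ⟨N, hN⟩ := eventually_atTop.1 (h.eventually (Ioo_mem_nhds (sub_lt_self L hδ0)
    (lt_add_of_pos_right L hδ0)))
  obtain ⟨M₁, hM₁⟩ := exists_nat_gt (4 / L)
  obtain ⟨M₂, hM₂⟩ := exists_nat_gt (2 / ε)
  refine eventually_atTop.2 ⟨N + M₁ + M₂ + 1, fun n hn => ?_⟩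
  by_contra! hlt
  have hn0 : (0 : ℝ) < n := by exact_mod_cast (by omega : 0 < n)
  have hLn : 4 < L * n := by
    have : 4 / L < n := hM₁.trans_le (by exact_mod_cast (by omega : M₁ ≤ n))
    rw [div_lt_iff₀ hL] at this
    linarith
  have hεn : 2 < ε * n := by
    have : 2 / ε < n := hM₂.trans_le (by exact_mod_cast (by omega : M₂ ≤ n))
    rw [div_lt_iff₀ hε0] at this
    linarith
  set k := ⌊ε * n⌋₊ with hk
  have hk₁ : (k : ℝ) ≤ ε * n := Nat.floor_le (by positivity)
  have hk₂ : ε * n / 2 ≤ k := by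
    have := Nat.lt_floor_add_one (ε * n)
    linarith
  have hkn : (k : ℝ) ≤ n := hk₁.trans (by nlinarith)
  have hk0 : (0 : ℝ) ≤ k := k.cast_nonneg
  have hS₁ : (BinWord.sumSq (binPrefix x n) : ℝ) < (L + δ) * (n : ℝ) ^ 3 := by
    have := (hN n (by omega)).2
    rwa [div_lt_iff₀ (by positivity)] at this
  have hS₂ : (L - δ) * ((n : ℝ) + k) ^ 3 < BinWord.sumSq (binPrefix x (n + k)) := by
    have := (hN (n + k) (by omega)).1
    rw [lt_div_iff₀ (by push_cast; positivity)] at this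
    exact_mod_cast this
  have hS₃ : (BinWord.sumSq (binPrefix x (n + k)) : ℝ) ≤ BinWord.sumSq (binPrefix x n) +
      k * (n + k + 2 * (suffixOverlap x n + k * (n + k))) := by
    exact_mod_cast sumSq_binPrefix_add_le x n k
  have h₁ : (k : ℝ) * (n + k + 2 * (suffixOverlap x n + k * (n + k))) ≤
      k * (2 * n + L * n ^ 2 + 4 * (ε * n) * n) := by
    refine mul_le_mul_of_nonneg_left ?_ hk0
    have : (k : ℝ) * (n + k) ≤ ε * n * (2 * n) :=
      mul_le_mul hk₁ (by linarith) (by positivity) (by positivity)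
    nlinarith
  have h₂ : (n : ℝ) ^ 3 + 3 * n ^ 2 * k ≤ (n + k) ^ 3 := by
    have : (n + k : ℝ) ^ 3 = n ^ 3 + 3 * n ^ 2 * k + (3 * n * k ^ 2 + k ^ 3) := by ring
    have : (0 : ℝ) ≤ 3 * n * k ^ 2 + k ^ 3 := by positivity
    linarith
  have h₃ : ((n : ℝ) + k) ^ 3 ≤ 8 * n ^ 3 := by
    calc ((n : ℝ) + k) ^ 3 ≤ (2 * n) ^ 3 := by gcongr; linarith
      _ = _ := by ring
  have h₄ := mul_le_mul_of_nonneg_left h₂ hL.le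
  have h₅ := mul_le_mul_of_nonneg_left h₃ hδ0.le
  -- collecting terms, `k` times an expression of size `L * n ^ 2` is at most `9 * δ * n ^ 3`
  have h₆ : (k : ℝ) * (L * n ^ 2 - 2 * n) < 9 * δ * n ^ 3 := by
    have : (k : ℝ) * (4 * (ε * n) * n) ≤ k * (L * n ^ 2) := by
      refine mul_le_mul_of_nonneg_left ?_ hk0
      nlinarith [sq_nonneg (n : ℝ)]
    linarith
  have h₇ : L * n ^ 2 / 2 ≤ L * (n : ℝ) ^ 2 - 2 * n := by nlinarith
  have h₈ : ε * n / 2 * (L * n ^ 2 / 2) ≤ k * (L * (n : ℝ) ^ 2 - 2 * n) :=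
    mul_le_mul hk₂ h₇ (by positivity) hk0
  have h₉ : 0 < L * ε * (n : ℝ) ^ 3 := by positivity
  rw [hδ] at h₆
  linarith

/-! ### Cubic growth of eventually periodic sequences -/

theorem apply_add_mul_of_le {x : ℕ → Fin 2} {h p : ℕ} (hp : ∀ i, h ≤ i → x (i + p) = x i)
    {i : ℕ} (hi : h ≤ i) (q : ℕ) : x (i + p * q) = x i := by
  induction q with
  | zero => simp
  | succ q ih => rw [Nat.mul_succ, ← add_assoc, hp _ (by omega), ih]

/-- The least period `p` of the tail divides every period of a tail. -/
theorem EventuallyPeriodic.exists_minimal {x : ℕ → Fin 2} (hx : EventuallyPeriodic x) :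
    ∃ h p : ℕ, 0 < p ∧ (∀ i, h ≤ i → x (i + p) = x i) ∧
      ∀ h' k : ℕ, (∀ i, h' ≤ i → x (i + k) = x i) → p ∣ k := by
  classical
  have hex : ∃ p, 0 < p ∧ ∃ h, ∀ i, h ≤ i → x (i + p) = x i := by
    obtain ⟨h, k, hk, hkx⟩ := hx
    exact ⟨k, hk, h, hkx⟩
  obtain ⟨hp, h, hpx⟩ := Nat.find_spec hex
  refine ⟨h, Nat.find hex, hp, hpx, fun h' k hk => Nat.dvd_of_mod_eq_zero ?_⟩
  by_contra hne
  refine Nat.find_min hex (Nat.mod_lt k hp) ⟨Nat.pos_of_ne_zero hne, h + h', fun i hi => ?_⟩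
  rw [← apply_add_mul_of_le hpx (by omega) (k / Nat.find hex), add_assoc, Nat.mod_add_div,
    hk i (by omega)]

/-- Two positions of a sequence with least period `p` either are congruent, and then agree back to
the preperiod, or differ within the last `h + p` letters. -/
theorem abs_lcs_sub_le {x : ℕ → Fin 2} {h p : ℕ} (hp : 0 < p)
    (hpx : ∀ i, h ≤ i → x (i + p) = x i)
    (hmin : ∀ h' k : ℕ, (∀ i, h' ≤ i → x (i + k) = x i) → p ∣ k) {a b : ℕ} (hab : a ≤ b) :
    |(lcs x a b : ℝ) - (if p ∣ b - a then a else 0 : ℕ)| ≤ h + p := by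
  split_ifs with hd
  · have h₁ : lcs x a b ≤ a := lcs_le_left x a b
    have h₂ : a - h ≤ lcs x a b := by
      refine (le_lcs_iff x a b _).2 ⟨by omega, by omega, fun t ht => ?_⟩
      obtain ⟨q, hq⟩ := hd
      rw [← apply_add_mul_of_le hpx (by omega) q, ← hq]
      congr 1
      omega
    have h₁' : (lcs x a b : ℝ) ≤ a := by exact_mod_cast h₁
    have h₂' : (a : ℝ) ≤ lcs x a b + h := by exact_mod_cast (by omega : a ≤ lcs x a b + h)
    have := (Nat.cast_nonneg p : (0 : ℝ) ≤ p)
    have := (Nat.cast_nonneg h : (0 : ℝ) ≤ h)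
    rw [abs_le]
    constructor <;> linarith
  · have hlt : lcs x a b < h + p := by
      by_contra! hle
      obtain ⟨ha, -, hagree⟩ := (le_lcs_iff x a b _).1 hle
      refine hd (hmin (a - p) (b - a) fun i hi => ?_)
      -- the agreement on the `p` letters before `a` propagates to the whole tail
      obtain ⟨r, q, hr, rfl⟩ : ∃ r q, r < p ∧ i = a - p + r + p * q :=
        ⟨(i - (a - p)) % p, (i - (a - p)) / p, Nat.mod_lt _ hp, by
          rw [add_assoc, Nat.mod_add_div]; omega⟩
      rw [apply_add_mul_of_le hpx (by omega), add_right_comm,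
        apply_add_mul_of_le hpx (by omega)]
      have := hagree (p - 1 - r) (by omega)
      rw [show a - 1 - (p - 1 - r) = a - p + r by omega,
        show b - 1 - (p - 1 - r) = a - p + r + (b - a) by omega] at this
      exact this.symm
    have : (lcs x a b : ℝ) ≤ h + p := by exact_mod_cast hlt.le
    simpa using this

/-- The sum of the numbers `a < b` congruent to `b` modulo `p`. -/
def sumCongr (p b : ℕ) : ℕ := ∑ a ∈ Finset.range b, if p ∣ b - a then a else 0

theorem sumCongr_add (p c : ℕ) (hp : 0 < p) : sumCongr p (c + p) = sumCongr p c + c := by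
  unfold sumCongr
  rw [Finset.sum_range_add]
  congr 1
  · refine Finset.sum_congr rfl fun a ha => ?_
    have := Finset.mem_range.1 ha
    rw [show c + p - a = (c - a) + p by omega]
    simp
  · rw [Finset.sum_eq_single_of_mem 0 (Finset.mem_range.2 hp)]
    · simp
    · intro i hi hi0
      have := Finset.mem_range.1 hi
      refine if_neg fun hd => ?_
      have := Nat.le_of_dvd (by omega) hd
      omega

theorem abs_sumCongr_sub_le {p : ℕ} (hp : 0 < p) (b : ℕ) :
    |2 * p * (sumCongr p b : ℝ) - b * (b - p)| ≤ (p : ℝ) ^ 2 := by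
  induction b using Nat.strong_induction_on with
  | _ b ih =>
    rcases lt_or_ge b p with hb | hb
    · have : sumCongr p b = 0 := by
        refine Finset.sum_eq_zero fun a ha => if_neg fun hd => ?_
        have := Finset.mem_range.1 ha
        have := Nat.le_of_dvd (by omega) hd
        omega
      have hb' : (b : ℝ) < p := by exact_mod_cast hb
      have hb0 : (0 : ℝ) ≤ b := b.cast_nonneg
      rw [this, abs_le]
      constructor <;> push_cast <;> nlinarith
    · obtain ⟨c, rfl⟩ := Nat.exists_eq_add_of_le' hb
      have := ih c (by omega)
      rw [sumCongr_add p c hp]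
      convert this using 2
      push_cast
      ring

theorem abs_suffixOverlap_sub_le {x : ℕ → Fin 2} {h p : ℕ} (hp : 0 < p)
    (hpx : ∀ i, h ≤ i → x (i + p) = x i)
    (hmin : ∀ h' k : ℕ, (∀ i, h' ≤ i → x (i + k) = x i) → p ∣ k) (b : ℕ) :
    |2 * p * (suffixOverlap x b : ℝ) - (b : ℝ) ^ 2| ≤
      (2 * p * (h + p) + p) * b + (p : ℝ) ^ 2 := by
  have h₁ : |(suffixOverlap x b : ℝ) - sumCongr p b| ≤ b * (h + p) := by
    unfold suffixOverlap sumCongr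
    rw [Nat.cast_sum, Nat.cast_sum, ← Finset.sum_sub_distrib]
    refine (Finset.abs_sum_le_sum_abs _ _).trans ?_
    refine (Finset.sum_le_sum fun a ha =>
      abs_lcs_sub_le hp hpx hmin (Finset.mem_range.1 ha).le).trans ?_
    simp [mul_add]
  have h₂ := abs_sumCongr_sub_le hp b
  have hp0 : (0 : ℝ) < p := by exact_mod_cast hp
  rw [abs_le] at h₁ h₂ ⊢
  have h₃ := mul_le_mul_of_nonneg_left h₁.1 hp0.le
  have h₄ := mul_le_mul_of_nonneg_left h₁.2 hp0.le
  have : (0 : ℝ) ≤ p * b := by positivity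
  constructor <;> linarith

/-- Summing the overlaps of a sequence with least period `p` gives `Σ ~ n ^ 3 / (3 * p)`. -/
theorem EventuallyPeriodic.exists_tendsto {x : ℕ → Fin 2} (hx : EventuallyPeriodic x) :
    ∃ L : ℝ, 0 < L ∧
      Tendsto (fun n : ℕ => (BinWord.sumSq (binPrefix x n) : ℝ) / (n : ℝ) ^ 3) atTop (𝓝 L) := by
  obtain ⟨h, p, hp, hpx, hmin⟩ := hx.exists_minimal
  have hp0 : (0 : ℝ) < p := by exact_mod_cast hp
  set K : ℝ := 3 * (2 * p * (h + p) + p + p ^ 2) + 3 * p + 3 with hK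
  have hK0 : 0 ≤ K := by positivity
  have hbound : ∀ n : ℕ, |3 * p * (BinWord.sumSq (binPrefix x n) : ℝ) - (n : ℝ) ^ 3| ≤
      K * ((n : ℝ) + 1) ^ 2 := by
    intro n
    induction n with
    | zero => simpa [sumSq_binPrefix, lcs] using hK0
    | succ n ih =>
      have h₁ := abs_suffixOverlap_sub_le hp hpx hmin (n + 1)
      have hn : (0 : ℝ) ≤ n := n.cast_nonneg
      rw [sumSq_binPrefix_succ]
      push_cast at h₁ ⊢
      set S : ℝ := (BinWord.sumSq (binPrefix x n) : ℝ)
      set f : ℝ := (suffixOverlap x (n + 1) : ℝ)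
      have h₂ : |3 * (2 * p * f - ((n : ℝ) + 1) ^ 2) + (3 * p * (n + 1) + 3 * n + 2)| ≤
          K * (n + 1) := by
        have hsq : (p : ℝ) ^ 2 ≤ p ^ 2 * (n + 1) :=
          le_mul_of_one_le_right (by positivity) (by linarith)
        have : (0 : ℝ) ≤ p * (n + 1) := by positivity
        rw [abs_le] at h₁ ⊢
        constructor <;> linarith
      calc |3 * p * (S + (n + 1) + 2 * f) - ((n : ℝ) + 1) ^ 3|
          = |(3 * p * S - (n : ℝ) ^ 3) +
              (3 * (2 * p * f - ((n : ℝ) + 1) ^ 2) + (3 * p * (n + 1) + 3 * n + 2))| := by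
            congr 1; ring
        _ ≤ K * ((n : ℝ) + 1) ^ 2 + K * (n + 1) := (abs_add_le _ _).trans (add_le_add ih h₂)
        _ ≤ K * ((n : ℝ) + 1 + 1) ^ 2 := by
            rw [← mul_add]
            exact mul_le_mul_of_nonneg_left (by nlinarith) hK0
  refine ⟨1 / (3 * p), by positivity, ?_⟩
  rw [tendsto_iff_norm_sub_tendsto_zero]
  refine squeeze_zero' (Eventually.of_forall fun n => norm_nonneg _) ?_
    (tendsto_const_div_atTop_nhds_zero_nat (4 * K / (3 * p)))
  filter_upwards [eventually_ge_atTop 1] with n hn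
  have hn1 : (1 : ℝ) ≤ n := by exact_mod_cast hn
  have hn0 : (0 : ℝ) < n := by linarith
  have heq : (BinWord.sumSq (binPrefix x n) : ℝ) / (n : ℝ) ^ 3 - 1 / (3 * p) =
      (3 * p * (BinWord.sumSq (binPrefix x n) : ℝ) - (n : ℝ) ^ 3) / (3 * p * n ^ 3) := by
    field_simp
  rw [heq, Real.norm_eq_abs, abs_div, abs_of_pos (by positivity : (0 : ℝ) < 3 * p * n ^ 3),
    div_div, div_le_div_iff₀ (by positivity) (by positivity)]
  have h₁ : ((n : ℝ) + 1) ^ 2 ≤ 4 * n ^ 2 := by nlinarith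
  calc _ ≤ K * (4 * (n : ℝ) ^ 2) * (3 * p * n) :=
        mul_le_mul_of_nonneg_right
          ((hbound n).trans (mul_le_mul_of_nonneg_left h₁ hK0)) (by positivity)
    _ = _ := by ring

theorem theorem2 (x : ℕ → Fin 2) :
    EventuallyPeriodic x ↔
      ∃ L : ℝ, 0 < L ∧
        Tendsto (fun n : ℕ => (BinWord.sumSq (binPrefix x n) : ℝ) / (n : ℝ) ^ 3) atTop (𝓝 L) := by
  exact ⟨EventuallyPeriodic.exists_tendsto, fun ⟨_, hL, h⟩ =>
    eventuallyPeriodic_of_le_suffixOverlap (half_pos hL) (le_suffixOverlap_of_tendsto hL h)⟩
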